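/- Let $n=2k+1$ be odd. Consider the pairs $(P,\xi)$, where $P=(p_1,\dots,p_n)$ is a closed polygon in $\mathbb{R}^3$ all of whose edges have length one, that is, $|p_ip_{i+1}|=1$ for $i=1,\dots,n$ with $p_{n+1}=p_1$, and where $\xi\in S^2$ is a unit vector. Let $\widetilde{M}_3(n)$ be the decorated configuration space, i.e. the set of all such pairs modulo the diagonal action of the orientation preserving isometries of $\mathbb{R}^3$ (an isometry acts on $P$, and its linear part acts on $\xi$), with the quotient smooth structure. Let $S:\widetilde{M}_3(n)\to\mathbb{R}$ be the area function $$2S(P,\xi)=\langle p_1\times p_2+p_2\times p_3+\dots+p_n\times p_1,\ \xi\rangle .$$ Then $(P,\xi)$ is a critical point of $S$ if and only if $P$ is a planar cyclic polygon (its vertices lie in a plane and on a circle) and $\xi$ is orthogonal to the affine hull of $P$. If $(P,\xi)$ is a critical point of $S$, then $(P,-\xi)$ is a critical point of $S$ as well. -/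

import Mathlib

open Topology
open scoped ContDiff

noncomputable section

namespace DecoratedLinkage

/-- Euclidean 3-space. -/
abbrev E3 : Type := EuclideanSpace ℝ (Fin 3)

/-- The cross product on Euclidean 3-space. -/
def cross (u v : E3) : E3 := WithLp.toLp 2 (crossProduct u.ofLp v.ofLp)

/-- An `n`-tuple of vertices together with a vector. -/
abbrev Ambient (n : ℕ) : Type := (Fin n → E3) × E3

/-- Pairs `(P, ξ)`, with `P` a closed polygon in 3-space all of whose `n` edges have length one
(the indices of the vertices are read modulo `n`), and `ξ` in the unit sphere centered at the
origin. These are the pairs before factorization by isometries. -/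
def DecoratedPolygon (n : ℕ) [NeZero n] : Type :=
  {c : Ambient n // (∀ i : Fin n, dist (c.1 i) (c.1 (i + 1)) = 1) ∧ c.2 ∈ Metric.sphere (0 : E3) 1}

namespace DecoratedPolygon

variable {n : ℕ} [NeZero n]

/-- The vertices of the polygon. -/
def vertex (c : DecoratedPolygon n) : Fin n → E3 := c.1.1

/-- The unit vector that decorates the polygon. -/
def xi (c : DecoratedPolygon n) : E3 := c.1.2

/-- The pair `(P, -ξ)`. -/
def flip (c : DecoratedPolygon n) : DecoratedPolygon n :=
  ⟨(c.1.1, -c.1.2), c.2.1, by simpa using c.2.2⟩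

/-- The vector `p₁ × p₂ + p₂ × p₃ + ⋯ + pₙ × p₁`. -/
def areaVector (c : DecoratedPolygon n) : E3 :=
  ∑ i : Fin n, cross (c.vertex i) (c.vertex (i + 1))

/-- The area of a decorated polygon: `2 S(P, ξ)` is the scalar product of the area vector
with `ξ`. -/
def area (c : DecoratedPolygon n) : ℝ := (1 / 2) * inner ℝ c.areaVector c.xi

/-- Two decorated polygons are equivalent if an orientation preserving isometry of 3-space carries
one to the other. The isometry acts on points, and its linear part acts on the vector. -/
def Equivalent (c d : DecoratedPolygon n) : Prop :=
  ∃ g : E3 ≃ᵃⁱ[ℝ] E3,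
    0 < LinearMap.det (g.linearIsometryEquiv.toLinearEquiv : E3 →ₗ[ℝ] E3) ∧
      (∀ i, d.vertex i = g (c.vertex i)) ∧ d.xi = g.linearIsometryEquiv c.xi

theorem Equivalent.refl (c : DecoratedPolygon n) : Equivalent c c :=
  ⟨AffineIsometryEquiv.refl ℝ E3, by
    have : (((AffineIsometryEquiv.refl ℝ E3).linearIsometryEquiv).toLinearEquiv : E3 →ₗ[ℝ] E3)
        = LinearMap.id := rfl
    rw [this, LinearMap.det_id]; exact one_pos, fun _ => rfl, rfl⟩

theorem Equivalent.symm {c d : DecoratedPolygon n} (h : Equivalent c d) : Equivalent d c := by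
  obtain ⟨g, hg, h1, h2⟩ := h
  refine ⟨g.symm, ?_, fun i => by rw [h1]; exact (g.symm_apply_apply _).symm, ?_⟩
  · have h3 := LinearEquiv.det_symm_mul_det g.linearIsometryEquiv.toLinearEquiv
    exact pos_of_mul_pos_left (by rw [mul_comm] at h3 ⊢; exact h3 ▸ one_pos) hg.le
  · rw [h2]; exact (g.linearIsometryEquiv.symm_apply_apply _).symm

theorem Equivalent.trans {c d e : DecoratedPolygon n} (h : Equivalent c d)
    (h' : Equivalent d e) : Equivalent c e := by
  obtain ⟨g, hg, h1, h2⟩ := h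
  obtain ⟨k, hk, h3, h4⟩ := h'
  refine ⟨g.trans k, ?_, fun i => by rw [h3, h1]; rfl, by rw [h4, h2]; rfl⟩
  have : ((g.trans k).linearIsometryEquiv.toLinearEquiv : E3 →ₗ[ℝ] E3)
      = (k.linearIsometryEquiv.toLinearEquiv : E3 →ₗ[ℝ] E3) ∘ₗ
        (g.linearIsometryEquiv.toLinearEquiv : E3 →ₗ[ℝ] E3) := rfl
  rw [this, LinearMap.det_comp]
  exact mul_pos hk hg

/-- Equivalence of decorated polygons, as a setoid. -/
def setoid (n : ℕ) [NeZero n] : Setoid (DecoratedPolygon n) where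
  r := Equivalent
  iseqv := ⟨Equivalent.refl, Equivalent.symm, Equivalent.trans⟩

theorem inner_cross (u v w : E3) :
    inner ℝ (cross u v) w = (EuclideanSpace.basisFun (Fin 3) ℝ).toBasis.det ![u, v, w] := by
  rw [Module.Basis.det_apply, Matrix.det_fin_three]
  simp [PiLp.inner_apply, Fin.sum_univ_three, cross, cross_apply, Module.Basis.toMatrix_apply]
  ring

theorem inner_cross_map (L : E3 ≃ₗᵢ[ℝ] E3)
    (hL : 0 < LinearMap.det (L.toLinearEquiv : E3 →ₗ[ℝ] E3)) (u v w : E3) :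
    inner ℝ (cross (L u) (L v)) (L w) = inner ℝ (cross u v) w := by
  have h1 : LinearMap.det (L.toLinearEquiv : E3 →ₗ[ℝ] E3) = 1 := by
    have h := LinearMap.normDet_eq_abs_det (L.toLinearEquiv : E3 →ₗ[ℝ] E3)
    have h' : (L.toLinearEquiv : E3 →ₗ[ℝ] E3).normDet = 1 := L.toLinearIsometry.normDet_eq_one
    rw [h', abs_of_pos hL] at h
    exact h.symm
  rw [inner_cross, inner_cross]
  have h2 := (EuclideanSpace.basisFun (Fin 3) ℝ).toBasis.det_comp
    (L.toLinearEquiv : E3 →ₗ[ℝ] E3) ![u, v, w]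
  rw [h1, one_mul] at h2
  rw [← h2]
  congr 1
  ext i : 1
  fin_cases i <;> rfl

theorem cross_add_add (u v t : E3) :
    cross (u + t) (v + t) = cross u v + (cross u t - cross v t) := by
  have h := cross_anticomm t.ofLp v.ofLp
  ext i
  simp only [cross, WithLp.ofLp_add, map_add, LinearMap.add_apply, cross_self, ← h,
    PiLp.add_apply, PiLp.sub_apply, Pi.add_apply, Pi.neg_apply, Pi.zero_apply]
  ring

theorem Equivalent.area_eq {c d : DecoratedPolygon n} (h : Equivalent c d) : c.area = d.area := by
  obtain ⟨g, hg, h1, h2⟩ := h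
  set L := g.linearIsometryEquiv with hL
  have hgx : ∀ x : E3, g x = L x + g 0 := fun x => by
    have := g.map_vadd 0 x
    simpa using this
  have hv : d.areaVector = ∑ i : Fin n, cross (L (c.vertex i)) (L (c.vertex (i + 1))) := by
    have hs : ∑ i : Fin n, cross (L (c.vertex (i + 1))) (g 0)
        = ∑ i : Fin n, cross (L (c.vertex i)) (g 0) :=
      Equiv.sum_comp (Equiv.addRight (1 : Fin n)) fun i => cross (L (c.vertex i)) (g 0)
    unfold areaVector
    simp only [h1, hgx (c.vertex _), cross_add_add, Finset.sum_add_distrib,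
      Finset.sum_sub_distrib, hs, sub_self, add_zero]
  rw [area, area, hv, h2, sum_inner, areaVector, sum_inner]
  simp only [inner_cross_map L hg]

end DecoratedPolygon

/-- The decorated configuration space: decorated polygons up to the diagonal action of the
orientation preserving isometries of 3-space. -/
def DecoratedSpace (n : ℕ) [NeZero n] : Type := Quotient (DecoratedPolygon.setoid n)

variable {n : ℕ} [NeZero n]

/-- The class of a decorated polygon in the decorated configuration space. -/
def DecoratedPolygon.toSpace (c : DecoratedPolygon n) : DecoratedSpace n :=
  Quotient.mk (DecoratedPolygon.setoid n) c

/-- The area function `S` on the decorated configuration space. -/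
def S : DecoratedSpace n → ℝ :=
  Quotient.lift DecoratedPolygon.area fun _ _ h => DecoratedPolygon.Equivalent.area_eq h

/-- A curve in the decorated configuration space is smooth at time `0`, for the quotient smooth
structure, if near `0` it is the class of a smooth curve of decorated polygons (smooth as a curve
in the ambient vector space). -/
def SmoothCurveAtZero (γ : ℝ → DecoratedSpace n) : Prop :=
  ∃ c : ℝ → DecoratedPolygon n,
    ContDiffAt ℝ ∞ (fun t => ((c t).1 : Ambient n)) 0 ∧ ∀ᶠ t in 𝓝 (0 : ℝ), γ t = (c t).toSpace

/-- A point `x` of the decorated configuration space is a critical point of the function `f`: the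
derivative of `f` along every smooth curve through `x` exists and vanishes, that is, the
differential of `f` at `x` is zero. -/
def IsCriticalPoint (f : DecoratedSpace n → ℝ) (x : DecoratedSpace n) : Prop :=
  ∀ γ : ℝ → DecoratedSpace n, SmoothCurveAtZero γ → γ 0 = x → HasDerivAt (fun t => f (γ t)) 0 0

/-- The polygon is planar and cyclic: its vertices lie in a plane and on a circle, that is, they
are coplanar and equidistant from some point. -/
def DecoratedPolygon.IsPlanarCyclic (c : DecoratedPolygon n) : Prop :=
  EuclideanGeometry.Concyclic (Set.range c.vertex)

/-- The vector `ξ` is orthogonal to the affine hull of the vertices. -/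
def DecoratedPolygon.XiOrthogonal (c : DecoratedPolygon n) : Prop :=
  ∀ v ∈ (affineSpan ℝ (Set.range c.vertex)).direction, inner ℝ v c.xi = 0

end DecoratedLinkage

end

noncomputable section

namespace DecoratedLinkage

/-! ### The cross product -/

/-! This is a Lagrange multiplier argument. Write `e i` for the edges; the constraints are the edge
lengths. They are independent because `n` is odd (`surjective_dHalfSqEdges`), so criticality yields
numbers `μ i` with `(e (i+1) + e i) × ξ = μ i • e i - μ (i+1) • e (i+1)` (`exists_multipliers`).
Pairing this relation with `e (i+1) + e i` shows that `μ i ^ 2` is constant, and pairing it with `ξ`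
shows that `μ i * ⟪e i, ξ⟫` is constant. An odd number of signs cannot cancel, which forces `μ ≠ 0`
and then `⟪e i, ξ⟫ = 0`. Crossing the relation with `ξ` exhibits a common circumcentre. Conversely,
around the circumcentre the multipliers can be written down as areas of triangles
(`cross_sub_eq_of_inscribed`), and the area vector is parallel to `ξ`, so rotating `ξ` has no first
order effect. Being inscribed does not depend on the sign of `ξ`, which gives the last claim. -/

theorem cross_add_left (u v w : E3) : cross (u + v) w = cross u w + cross v w := by
  simp [cross]

theorem cross_add_right (u v w : E3) : cross u (v + w) = cross u v + cross u w := by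
  simp [cross]

theorem cross_smul_left (a : ℝ) (u v : E3) : cross (a • u) v = a • cross u v := by
  simp [cross]

theorem cross_smul_right (a : ℝ) (u v : E3) : cross u (a • v) = a • cross u v := by
  simp [cross]

theorem cross_sub_left (u v w : E3) : cross (u - v) w = cross u w - cross v w := by
  simp [cross]

theorem cross_zero_left (v : E3) : cross 0 v = 0 := by
  simp [cross]

theorem inner_cross_left (u v w : E3) : inner ℝ (cross u v) w = inner ℝ u (cross v w) := by
  simp [PiLp.inner_apply, Fin.sum_univ_three, cross, cross_apply]
  ring

theorem inner_cross_left' (u v w : E3) : inner ℝ (cross u v) w = -inner ℝ v (cross u w) := by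
  simp [PiLp.inner_apply, Fin.sum_univ_three, cross, cross_apply]
  ring

theorem inner_cross_skew (u v w : E3) : inner ℝ u (cross v w) = -inner ℝ v (cross u w) := by
  rw [← inner_cross_left, inner_cross_left']

theorem inner_self_cross (u v : E3) : inner ℝ u (cross u v) = 0 := by
  simp [PiLp.inner_apply, Fin.sum_univ_three, cross, cross_apply]
  ring

theorem inner_cross_self_right (u v : E3) : inner ℝ (cross u v) v = 0 := by
  simp [PiLp.inner_apply, Fin.sum_univ_three, cross, cross_apply]
  ring

theorem cross_cross (u v w : E3) :
    cross (cross u v) w = inner ℝ u w • v - inner ℝ v w • u := by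
  ext i
  fin_cases i <;> simp [PiLp.inner_apply, Fin.sum_univ_three, cross, cross_apply] <;> ring

theorem cross_cross_right (u w : E3) :
    cross (cross u w) w = inner ℝ u w • w - inner ℝ w w • u :=
  cross_cross u w w

theorem inner_cross_cross (u v w : E3) :
    inner ℝ (cross u w) (cross v w) = inner ℝ u v * inner ℝ w w - inner ℝ u w * inner ℝ v w := by
  rw [inner_cross_skew, cross_cross_right, inner_sub_right, inner_smul_right, inner_smul_right,
    real_inner_comm u v]
  ring

/-- Two vectors orthogonal to a common unit vector span a multiple of it under the cross
product. -/
theorem cross_eq_smul_of_inner_eq_zero {u v ξ : E3} (hξ : ‖ξ‖ = 1) (hu : inner ℝ u ξ = 0)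
    (hv : inner ℝ v ξ = 0) : cross u v = inner ℝ (cross u v) ξ • ξ := by
  have h := cross_cross_right (cross u v) ξ
  have h0 : cross (cross u v) ξ = 0 := by rw [cross_cross, hu, hv]; simp
  rw [h0, cross_zero_left, real_inner_self_eq_norm_sq, hξ, one_pow, one_smul] at h
  exact (sub_eq_zero.1 h.symm).symm

/-- The vectors `b`, `b × ξ`, `ξ` form an orthogonal basis, so identities can be tested against
them. -/
theorem eq_zero_of_inner_eq_zero {x b ξ : E3} (hξ : ‖ξ‖ = 1) (hb0 : b ≠ 0)
    (hb : inner ℝ b ξ = 0) (hx : inner ℝ x ξ = 0) (hxb : inner ℝ x b = 0)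
    (hxb' : inner ℝ x (cross b ξ) = 0) : x = 0 := by
  have h1 := cross_cross_right x b
  rw [cross_eq_smul_of_inner_eq_zero hξ hx hb, inner_cross_left, hxb', hxb, zero_smul, zero_smul,
    cross_zero_left, zero_sub, eq_comm, neg_eq_zero, smul_eq_zero, inner_self_eq_zero] at h1
  exact h1.resolve_left hb0

/-- The cross product as a continuous bilinear map. -/
def crossL : E3 →L[ℝ] E3 →L[ℝ] E3 :=
  (LinearMap.mk₂ ℝ cross cross_add_left cross_smul_left cross_add_right
    cross_smul_right).toContinuousBilinearMap

theorem crossL_apply (u v : E3) : crossL u v = cross u v := rfl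

theorem hasDerivAt_cross {f g : ℝ → E3} {f' g' : E3} {t : ℝ} (hf : HasDerivAt f f' t)
    (hg : HasDerivAt g g' t) :
    HasDerivAt (fun s => cross (f s) (g s)) (cross f' (g t) + cross (f t) g') t := by
  exact (crossL.hasFDerivAt.comp_hasDerivAt t hf).clm_apply hg

/-! ### Cyclic index sets -/

theorem cyclic_induction {n : ℕ} [NeZero n] {p : Fin n → Prop} (h0 : p 0)
    (h : ∀ i, p i → p (i + 1)) (i : Fin n) : p i := by
  obtain ⟨m, rfl⟩ := Nat.exists_eq_succ_of_ne_zero (NeZero.ne n)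
  induction i using Fin.induction with
  | zero => exact h0
  | succ i ih => simpa only [Fin.coeSucc_eq_succ] using h _ ih

theorem cyclic_const {n : ℕ} [NeZero n] {α : Type*} {f : Fin n → α}
    (h : ∀ i, f (i + 1) = f i) (i : Fin n) : f i = f 0 :=
  cyclic_induction (p := fun i => f i = f 0) rfl (fun i hi => (h i).trans hi) i

theorem sum_cyclic_succ {n : ℕ} [NeZero n] {M : Type*} [AddCommMonoid M] (f : Fin n → M) :
    ∑ i, f (i + 1) = ∑ i, f i :=
  Equiv.sum_comp (Equiv.addRight (1 : Fin n)) f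

/-- An odd number of vectors, each equal to `u` or `-u`, adds up to zero only if `u = 0`. -/
theorem eq_zero_of_sum_signs_eq_zero {n : ℕ} (hn : Odd n) {V : Type*} [AddCommGroup V]
    [Module ℝ V] {x : Fin n → V} {u : V} (hx : ∀ i, x i = u ∨ x i = -u) (hs : ∑ i, x i = 0) :
    u = 0 := by
  -- Signs are recorded as odd integers; a sum of an odd number of odd integers is odd, hence
  -- nonzero.
  have h : ∀ i, ∃ k : ℤ, x i = ((2 * k + 1 : ℤ) : ℝ) • u := fun i => by
    rcases hx i with h | h
    · exact ⟨0, by simp [h]⟩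
    · exact ⟨-1, by rw [h]; norm_num⟩
  choose k hk using h
  simp_rw [hk] at hs
  rw [← Finset.sum_smul, ← Int.cast_sum] at hs
  refine (smul_eq_zero.1 hs).resolve_left ?_
  rw [Int.cast_eq_zero, Finset.sum_add_distrib, ← Finset.mul_sum]
  obtain ⟨m, rfl⟩ := hn
  simp only [Finset.sum_const, Finset.card_univ, Fintype.card_fin]
  intro h0
  simp at h0
  omega

/-! ### Smooth curves in level sets -/

/-- Every vector in the kernel of a surjective differential is the velocity of a smooth curve in
the level set. -/
theorem exists_curve_in_level_set {E F : Type*} [NormedAddCommGroup E] [NormedSpace ℝ E]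
    [CompleteSpace E] [NormedAddCommGroup F] [NormedSpace ℝ F] [FiniteDimensional ℝ F]
    {G : E → F} {G' : E →L[ℝ] F} {p v : E} (hG : ContDiff ℝ ∞ G) (hG' : HasFDerivAt G G' p)
    (hs : Function.Surjective G') (hv : G' v = 0) :
    ∃ q : ℝ → E, ContDiffAt ℝ ∞ q 0 ∧ q 0 = p ∧ HasDerivAt q v 0 ∧
      ∀ᶠ t in 𝓝 (0 : ℝ), G (q t) = G p := by
  have : CompleteSpace F := FiniteDimensional.complete ℝ F
  obtain ⟨L, hL⟩ := G'.exists_rightInverse_of_surjective (LinearMap.range_eq_top.2 hs)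
  -- The curve is sought as `p + t • v + L (ψ t)`, with the correction `ψ` given by the implicit
  -- function theorem. At the origin `f` has partial derivative `G' v = 0` in `t` and the identity
  -- in `y`, so `ψ' 0 = 0` and the velocity is `v`.
  let A : ℝ × F →L[ℝ] E := (ContinuousLinearMap.toSpanSingleton ℝ v).coprod L
  let f : ℝ × F → F := fun x => G (p + A x)
  have hA0 : p + A 0 = p := by simp
  have hf : ContDiffAt ℝ ∞ f 0 := by
    have : ContDiff ℝ ∞ f := hG.comp (contDiff_const.add A.contDiff)
    exact this.contDiffAt
  have hf' : HasFDerivAt f (G' ∘L A) 0 := by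
    refine HasFDerivAt.comp (0 : ℝ × F) (g := G) ?_ (A.hasFDerivAt.const_add p)
    rwa [hA0]
  have hr : fderiv ℝ f 0 ∘L .inr ℝ ℝ F = ContinuousLinearMap.id ℝ F := by
    rw [hf'.fderiv, ← hL]; ext x; simp [A]
  have hl : fderiv ℝ f 0 ∘L .inl ℝ ℝ F = 0 := by
    rw [hf'.fderiv]; ext; simp [A, hv]
  have hi : (fderiv ℝ f 0 ∘L .inr ℝ ℝ F).IsInvertible := by
    rw [hr]; exact ⟨ContinuousLinearEquiv.refl ℝ F, rfl⟩
  have pn : (∞ : WithTop ℕ∞) ≠ 0 := by simp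
  have h1 := hf.implicitFunction_apply_self pn hi
  have h2 := hf.eventually_apply_implicitFunction pn hi
  have h3 := (hf.hasStrictFDerivAt_implicitFunction pn hi).hasFDerivAt
  have h4 := hf.contDiffAt_implicitFunction pn hi
  set ψ := hf.implicitFunction pn hi
  rw [hl, ContinuousLinearMap.comp_zero] at h3
  simp only [Prod.fst_zero, Prod.snd_zero] at h1 h2 h3 h4
  refine ⟨fun t => p + A (t, ψ t), ?_, ?_, ?_, ?_⟩
  · exact contDiffAt_const.add (A.contDiff.contDiffAt.comp _ (contDiffAt_id.prodMk h4))
  · simp only [h1]; exact hA0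
  · have h5 : HasDerivAt ψ 0 0 := by simpa using h3.hasDerivAt
    have h6 := A.hasFDerivAt.comp_hasDerivAt (0 : ℝ) ((hasDerivAt_id (0 : ℝ)).prodMk h5)
    have h7 : A (1, 0) = v := by simp [A]
    rw [h7] at h6
    exact h6.const_add p
  · filter_upwards [h2] with t ht
    simpa [f] using ht

variable {n : ℕ} [NeZero n]

/-! ### Inscribed polygons: planar cyclic polygons with normal vector `ξ`. -/

namespace DecoratedPolygon

/-- The vertices lie on a circle in a plane orthogonal to `ξ`. -/
def IsInscribed (c : DecoratedPolygon n) : Prop :=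
  ∃ (o : E3) (r : ℝ), ∀ i, dist (c.vertex i) o = r ∧ inner ℝ (c.vertex i - o) c.xi = 0

theorem norm_xi (c : DecoratedPolygon n) : ‖c.xi‖ = 1 := 
  mem_sphere_zero_iff_norm.1 c.2.2

theorem norm_edge (c : DecoratedPolygon n) (i : Fin n) :
    ‖c.vertex (i + 1) - c.vertex i‖ = 1 := by
  rw [← dist_eq_norm, dist_comm]; exact c.2.1 i

theorem Equivalent.isInscribed {c d : DecoratedPolygon n} (h : Equivalent c d)
    (hc : c.IsInscribed) : d.IsInscribed := by
  obtain ⟨g, -, h1, h2⟩ := h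
  obtain ⟨o, r, ho⟩ := hc
  refine ⟨g o, r, fun i => ⟨by rw [h1, g.dist_map]; exact (ho i).1, ?_⟩⟩
  have h3 : g (c.vertex i) - g o = g.linearIsometryEquiv (c.vertex i - o) := by
    simpa using (g.map_vsub (c.vertex i) o).symm
  rw [h1, h2, h3, LinearIsometryEquiv.inner_map_map]
  exact (ho i).2

theorem IsInscribed.isPlanarCyclic {c : DecoratedPolygon n} (h : c.IsInscribed) :
    c.IsPlanarCyclic := by
  obtain ⟨o, r, ho⟩ := h
  refine ⟨⟨o, r, Set.forall_mem_range.2 fun i => (ho i).1⟩, ?_⟩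
  have hle : vectorSpan ℝ (Set.range c.vertex) ≤ (Submodule.span ℝ {c.xi})ᗮ := by
    refine Submodule.span_le.2 ?_
    rintro _ ⟨_, ⟨i, rfl⟩, _, ⟨j, rfl⟩, rfl⟩
    beta_reduce
    rw [SetLike.mem_coe, Submodule.mem_orthogonal_singleton_iff_inner_left, vsub_eq_sub,
      ← sub_sub_sub_cancel_right _ _ o, inner_sub_left, (ho i).2, (ho j).2, sub_zero]
  refine (Submodule.rank_mono hle).trans ?_
  have hx : c.xi ≠ 0 := by
    rw [← norm_ne_zero_iff, c.norm_xi]; exact one_ne_zero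
  have : Fact (Module.finrank ℝ E3 = 2 + 1) := ⟨by simp⟩
  rw [← Module.finrank_eq_rank, Submodule.finrank_orthogonal_span_singleton (n := 2) hx]
  norm_num

theorem IsInscribed.xiOrthogonal {c : DecoratedPolygon n} (h : c.IsInscribed) :
    c.XiOrthogonal := by
  obtain ⟨o, r, ho⟩ := h
  intro v hv
  rw [direction_affineSpan] at hv
  rw [← Submodule.mem_orthogonal_singleton_iff_inner_left (𝕜 := ℝ)]
  refine (Submodule.span_le.2 ?_ : vectorSpan ℝ (Set.range c.vertex) ≤ _) hv
  rintro _ ⟨_, ⟨i, rfl⟩, _, ⟨j, rfl⟩, rfl⟩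
  beta_reduce
  rw [SetLike.mem_coe, Submodule.mem_orthogonal_singleton_iff_inner_left, vsub_eq_sub,
    ← sub_sub_sub_cancel_right _ _ o, inner_sub_left, (ho i).2, (ho j).2, sub_zero]

/-- The centre of a sphere through the vertices projects to the centre of a circle in the plane of
the polygon. -/
theorem isInscribed_iff (c : DecoratedPolygon n) :
    c.IsInscribed ↔ c.IsPlanarCyclic ∧ c.XiOrthogonal := by
  refine ⟨fun h => ⟨h.isPlanarCyclic, h.xiOrthogonal⟩, ?_⟩
  rintro ⟨⟨⟨o, r, ho⟩, -⟩, hx⟩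
  have hξ : inner ℝ c.xi c.xi = (1 : ℝ) := by
    rw [real_inner_self_eq_norm_sq, c.norm_xi, one_pow]
  have h1 : ∀ i, inner ℝ (c.vertex i - o) c.xi = inner ℝ (c.vertex 0 - o) c.xi := fun i => by
    have := hx (c.vertex i - c.vertex 0) (by
      rw [direction_affineSpan]
      exact vsub_mem_vectorSpan ℝ (Set.mem_range_self i) (Set.mem_range_self 0))
    rw [← sub_sub_sub_cancel_right _ _ o, inner_sub_left] at this
    exact sub_eq_zero.1 this
  set a := inner ℝ (c.vertex 0 - o) c.xi
  have h2 : ∀ i, inner ℝ (c.vertex i - (o + a • c.xi)) c.xi = 0 := fun i => by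
    rw [← sub_sub, inner_sub_left, h1, inner_smul_left, hξ]; simp
  refine ⟨o + a • c.xi, √(r ^ 2 - a ^ 2), fun i => ⟨?_, h2 i⟩⟩
  have h3 : ‖c.vertex i - o‖ = r := by
    rw [← dist_eq_norm]; exact ho _ (Set.mem_range_self i)
  have h4 : ‖c.vertex i - (o + a • c.xi)‖ ^ 2 = r ^ 2 - a ^ 2 := by
    rw [← sub_sub, norm_sub_sq_real, h3, inner_smul_right, h1, norm_smul, c.norm_xi, mul_one,
      Real.norm_eq_abs, sq_abs]
    ring
  rw [dist_eq_norm, ← h4, Real.sqrt_sq (norm_nonneg _)]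

theorem IsInscribed.flip {c : DecoratedPolygon n} (h : c.IsInscribed) : c.flip.IsInscribed := by
  obtain ⟨o, r, ho⟩ := h
  refine ⟨o, r, fun i => ⟨(ho i).1, ?_⟩⟩
  change inner ℝ (c.vertex i - o) (-c.xi) = 0
  rw [inner_neg_right, (ho i).2, neg_zero]

/-! ### The differential of the area -/

/-- The terms containing `o` cancel around the cycle, so the circumcentre may serve as origin. -/
theorem areaVector_eq_sum_sub (c : DecoratedPolygon n) (o : E3) :
    c.areaVector = ∑ i, cross (c.vertex i - o) (c.vertex (i + 1) - o) := by
  simp_rw [sub_eq_add_neg _ o, cross_add_add, Finset.sum_add_distrib, Finset.sum_sub_distrib]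
  rw [sum_cyclic_succ fun i => cross (c.vertex i) (-o), sub_self, add_zero, areaVector]

end DecoratedPolygon

/-- Collecting the terms by velocity identifies the gradient of `2 S` at the vertex `i + 1` as `(p
(i+2) - p i) × ξ`. -/
theorem sum_inner_cross_add (p v : Fin n → E3) (ξ : E3) :
    inner ℝ (∑ i, (cross (v i) (p (i + 1)) + cross (p i) (v (i + 1)))) ξ =
      ∑ i, inner ℝ (v (i + 1)) (cross (p (i + 1 + 1) - p i) ξ) := by
  simp_rw [sum_inner, inner_add_left, Finset.sum_add_distrib, cross_sub_left, inner_sub_right,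
    Finset.sum_sub_distrib, sub_eq_add_neg]
  rw [← sum_cyclic_succ fun i => inner ℝ (cross (v i) (p (i + 1))) ξ, ← Finset.sum_neg_distrib]
  simp_rw [inner_cross_left, inner_cross_skew (p _) (v _)]

/-- The differential of the area. -/
theorem hasDerivAt_area {c : ℝ → DecoratedPolygon n} {v : Fin n → E3} {w : E3}
    (hv : HasDerivAt (fun t => (c t).vertex) v 0) (hw : HasDerivAt (fun t => (c t).xi) w 0) :
    HasDerivAt (fun t => (c t).area)
      (1 / 2 * (∑ i, inner ℝ (v (i + 1))
        (cross ((c 0).vertex (i + 1 + 1) - (c 0).vertex i) (c 0).xi) +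
          inner ℝ (c 0).areaVector w)) 0 := by
  rw [hasDerivAt_pi] at hv
  have hA : HasDerivAt (fun t => (c t).areaVector)
      (∑ i, (cross (v i) ((c 0).vertex (i + 1)) + cross ((c 0).vertex i) (v (i + 1)))) 0 :=
    HasDerivAt.fun_sum fun i _ => hasDerivAt_cross (hv i) (hv (i + 1))
  rw [← sum_inner_cross_add, add_comm]
  exact (hA.inner ℝ hw).const_mul (1 / 2)

/-! ### Inscribed polygons are critical -/

/-- Along a polygon with unit edges inscribed in a circle around the origin, the gradient of the
area is a combination of the gradients of the edge lengths. -/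
theorem cross_sub_eq_of_inscribed {a b d ξ : E3} {r : ℝ} (hξ : ‖ξ‖ = 1)
    (ha : ‖a‖ = r) (hb : ‖b‖ = r) (hd : ‖d‖ = r) (ha' : inner ℝ a ξ = 0) (hb' : inner ℝ b ξ = 0)
    (hd' : inner ℝ d ξ = 0) (hab : ‖b - a‖ = 1) (hbd : ‖d - b‖ = 1) :
    cross (d - a) ξ = (2 * inner ℝ (cross a b) ξ) • (b - a) -
      (2 * inner ℝ (cross b d) ξ) • (d - b) := by
  have hξ' : inner ℝ ξ ξ = (1 : ℝ) := by rw [real_inner_self_eq_norm_sq, hξ, one_pow]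
  have hbb : inner ℝ b b = r ^ 2 := by rw [real_inner_self_eq_norm_sq, hb]
  have hab1 : inner ℝ a b = r ^ 2 - 1 / 2 := by
    have := norm_sub_sq_real b a
    rw [hab, ha, hb, real_inner_comm] at this
    linarith
  have hbd1 : inner ℝ b d = r ^ 2 - 1 / 2 := by
    have := norm_sub_sq_real d b
    rw [hbd, hd, hb, real_inner_comm] at this
    linarith
  have hb0 : b ≠ 0 := by
    rintro rfl
    rw [norm_zero] at hb
    rw [← hb, norm_eq_zero] at ha
    simp [ha] at hab
  -- The triangles spanned by the centre and an edge have sides `r`, `r`, `1`, so their signed areas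
  -- agree up to sign. The signs may differ, and only the squares are used.
  have key : ∀ u v : E3, ‖u‖ = r → ‖v‖ = r → inner ℝ u ξ = 0 → inner ℝ v ξ = 0 →
      inner ℝ u v = r ^ 2 - 1 / 2 →
      inner ℝ (cross u v) ξ ^ 2 = r ^ 2 * r ^ 2 - (r ^ 2 - 1 / 2) ^ 2 := by
    intro u v hu hv hu' hv' huv
    have h := inner_cross_cross u u v
    rw [huv, real_inner_self_eq_norm_sq u, real_inner_self_eq_norm_sq v, hu, hv,
      cross_eq_smul_of_inner_eq_zero hξ hu' hv', inner_smul_left, inner_smul_right, hξ',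
      RCLike.conj_to_real] at h
    linarith
  have hs := (key a b ha hb ha' hb' hab1).trans (key b d hb hd hb' hd' hbd1).symm
  set s := inner ℝ (cross a b) ξ with hsdef
  set s' := inner ℝ (cross b d) ξ with hsdef'
  have h1 : inner ℝ a (cross b ξ) = s := (inner_cross_left a b ξ).symm
  have h2 : inner ℝ b (cross d ξ) = s' := (inner_cross_left b d ξ).symm
  have h3 : inner ℝ b (cross a ξ) = -s := by rw [inner_cross_skew, h1]
  have h4 : inner ℝ d (cross b ξ) = -s' := by rw [inner_cross_skew, h2]
  -- The identity is tested against `ξ`, `b` and `b × ξ`; only the last component needs `s ^ 2 = s'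
  -- ^ 2`.
  rw [← sub_eq_zero]
  refine eq_zero_of_inner_eq_zero hξ hb0 hb' ?_ ?_ ?_
  · simp only [inner_sub_left, inner_smul_left, inner_cross_self_right, ha', hb', hd']
    simp
  · rw [real_inner_comm]
    simp only [inner_sub_right, inner_smul_right, cross_sub_left, h2, h3, hbb, hbd1,
      (real_inner_comm a b).trans hab1]
    ring
  · simp only [inner_sub_left, inner_smul_left, cross_sub_left, h1, h4, inner_cross_cross,
      inner_self_cross, (real_inner_comm b d).trans hbd1, hab1, ha', hb', hd', hξ', RCLike.conj_to_real]
    linear_combination 2 * hs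

/-! ### The constraint -/

/-- The halved squares of the edge lengths. -/
def halfSqEdges (p : Fin n → E3) (i : Fin n) : ℝ :=
  1 / 2 * inner ℝ (p (i + 1) - p i) (p (i + 1) - p i)

/-- The difference of two consecutive vertices, as a continuous linear map. -/
def edgeL (i : Fin n) : (Fin n → E3) →L[ℝ] E3 :=
  ContinuousLinearMap.proj (R := ℝ) (φ := fun _ : Fin n => E3) (i + 1) -
    ContinuousLinearMap.proj (R := ℝ) (φ := fun _ : Fin n => E3) i

/-- The differential of `halfSqEdges`. -/
def dHalfSqEdges (p : Fin n → E3) : (Fin n → E3) →L[ℝ] (Fin n → ℝ) :=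
  ContinuousLinearMap.pi fun i => (innerSL ℝ (p (i + 1) - p i)) ∘L edgeL i

theorem dHalfSqEdges_apply (p v : Fin n → E3) (i : Fin n) :
    dHalfSqEdges p v i = inner ℝ (p (i + 1) - p i) (v (i + 1) - v i) := rfl

theorem contDiff_halfSqEdges : ContDiff ℝ ∞ (halfSqEdges (n := n)) := by
  refine contDiff_pi.2 fun i => contDiff_const.mul ?_
  exact (edgeL i).contDiff.inner ℝ (edgeL i).contDiff

theorem hasFDerivAt_halfSqEdges (p : Fin n → E3) :
    HasFDerivAt halfSqEdges (dHalfSqEdges p) p := by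
  refine hasFDerivAt_pi.2 fun i => ?_
  have := (((edgeL i).hasFDerivAt (x := p)).inner ℝ (edgeL i).hasFDerivAt).const_mul (1 / 2)
  refine this.congr_fderiv ?_
  ext v
  change 1 / 2 * (inner ℝ (edgeL i p) (edgeL i v) + inner ℝ (edgeL i v) (edgeL i p)) =
    inner ℝ (edgeL i p) (edgeL i v)
  rw [real_inner_comm]
  ring

/-- Summation by parts around a polygon. -/
theorem sum_mul_dHalfSqEdges (p v : Fin n → E3) (ν : Fin n → ℝ) :
    ∑ i, ν i * dHalfSqEdges p v i =
      ∑ i, inner ℝ (v (i + 1))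
        (ν i • (p (i + 1) - p i) - ν (i + 1) • (p (i + 1 + 1) - p (i + 1))) := by
  simp_rw [dHalfSqEdges_apply, inner_sub_right (v _), inner_smul_right, Finset.sum_sub_distrib]
  rw [sum_cyclic_succ fun i => ν i * inner ℝ (v i) (p (i + 1) - p i), ← Finset.sum_sub_distrib]
  refine Finset.sum_congr rfl fun i _ => ?_
  rw [real_inner_comm, inner_sub_left]
  ring

theorem eq_of_forall_sum_inner_eq {a b : Fin n → E3}
    (h : ∀ v : Fin n → E3, ∑ i, inner ℝ (v (i + 1)) (a i) = ∑ i, inner ℝ (v (i + 1)) (b i)) :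
    a = b := by
  -- The shift makes the test vector at `i + 1` equal to `a i - b i`.
  have h1 := h fun i => a (i - 1) - b (i - 1)
  simp only [add_sub_cancel_right] at h1
  rw [← sub_eq_zero, ← Finset.sum_sub_distrib] at h1
  simp_rw [← inner_sub_right] at h1
  rw [Finset.sum_eq_zero_iff_of_nonneg fun i _ => real_inner_self_nonneg] at h1
  funext i
  exact sub_eq_zero.1 (inner_self_eq_zero.1 (h1 i (Finset.mem_univ i)))

theorem sum_edges_eq_zero (p : Fin n → E3) : ∑ i, (p (i + 1) - p i) = 0 := by
  rw [Finset.sum_sub_distrib, sum_cyclic_succ, sub_self]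

theorem linearFunctional_apply_eq_sum {m : ℕ} (φ : (Fin m → ℝ) →ₗ[ℝ] ℝ) (x : Fin m → ℝ) :
    φ x = ∑ i, φ (Pi.single i 1) * x i := by
  rw [LinearMap.pi_apply_eq_sum_univ φ x]
  refine Finset.sum_congr rfl fun i _ => ?_
  have : (fun j => if i = j then (1 : ℝ) else 0) = Pi.single i 1 := by
    ext j; simp [Pi.single_apply, eq_comm]
  rw [this, smul_eq_mul, mul_comm]

/-- A functional `ν` that kills the range makes `ν i • e i` constant around the polygon. If `ν ≠ 0`,
all unit edges equal `± e 0`, and an odd number of them cannot close up. -/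
theorem surjective_dHalfSqEdges (hn : Odd n) {p : Fin n → E3}
    (hp : ∀ i, ‖p (i + 1) - p i‖ = 1) : Function.Surjective (dHalfSqEdges p) := by
  rw [← ContinuousLinearMap.coe_coe, ← LinearMap.dualMap_injective_iff,
    injective_iff_map_eq_zero]
  intro φ hφ
  set ν : Fin n → ℝ := fun i => φ (Pi.single i 1)
  have hφν : ∀ x : Fin n → ℝ, φ x = ∑ i, ν i * x i :=
    linearFunctional_apply_eq_sum φ
  have h1 := eq_of_forall_sum_inner_eq (a := fun i => ν i • (p (i + 1) - p i) -
      ν (i + 1) • (p (i + 1 + 1) - p (i + 1))) (b := 0) fun v => by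
    rw [← sum_mul_dHalfSqEdges, ← hφν]
    simpa using LinearMap.congr_fun hφ v
  have h2 := cyclic_const (f := fun i => ν i • (p (i + 1) - p i)) fun i =>
    (sub_eq_zero.1 (congrFun h1 i)).symm
  have h3 : ∀ i, |ν i| = |ν 0| := fun i => by
    have := congrArg norm (h2 i)
    simpa only [norm_smul, hp, mul_one, Real.norm_eq_abs] using this
  have h4 : ν 0 = 0 := by
    by_contra h0
    have h5 := eq_zero_of_sum_signs_eq_zero hn (u := p (0 + 1) - p 0) (fun i => ?_)
      (sum_edges_eq_zero p)
    · have := hp 0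
      rw [h5] at this; simp at this
    · have h6 := h2 i
      rcases abs_eq_abs.1 (h3 i) with h | h
      · simp only [h] at h6; exact Or.inl (smul_right_injective _ h0 h6)
      · simp only [h, neg_smul, ← smul_neg] at h6
        exact Or.inr (neg_eq_iff_eq_neg.1 (smul_right_injective _ h0 h6))
  ext i
  have : ν i = 0 := by simpa [h4] using h3 i
  simpa using this

theorem halfSqEdges_vertex (c : DecoratedPolygon n) : halfSqEdges c.vertex = fun _ => 1 / 2 := by
  funext i
  rw [halfSqEdges, real_inner_self_eq_norm_sq, c.norm_edge]
  norm_num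

theorem isCriticalPoint_of_isInscribed {c : DecoratedPolygon n} (hc : c.IsInscribed) :
    IsCriticalPoint S c.toSpace := by
  rintro γ ⟨d, hd, hγ⟩ h0
  -- The lifted curve starts at a polygon that is only equivalent to `c`.
  have hd0 : (d 0).IsInscribed :=
    (Quotient.exact (h0.symm.trans hγ.self_of_nhds)).isInscribed hc
  have hdiff := (hd.differentiableAt (by simp)).hasDerivAt
  set vw := deriv (fun t => ((d t).1 : Ambient n)) 0
  have hv : HasDerivAt (fun t => (d t).vertex) vw.1 0 := hdiff.fst
  have hw : HasDerivAt (fun t => (d t).xi) vw.2 0 := hdiff.snd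
  obtain ⟨o, r, ho⟩ := hd0
  have hξ := (d 0).norm_xi
  have hvk : dHalfSqEdges (d 0).vertex vw.1 = 0 := by
    have h1 := (hasFDerivAt_halfSqEdges (d 0).vertex).comp_hasDerivAt (0 : ℝ) hv
    have h2 : halfSqEdges ∘ (fun t => (d t).vertex) = fun _ _ => 1 / 2 :=
      funext fun t => halfSqEdges_vertex (d t)
    rw [h2] at h1
    exact h1.unique (hasDerivAt_const _ _)
  have hwk : inner ℝ (d 0).xi vw.2 = 0 := by
    have h1 := hw.inner ℝ hw
    have h2 : (fun t => inner ℝ (d t).xi (d t).xi) = fun _ => (1 : ℝ) := funext fun t => by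
      rw [real_inner_self_eq_norm_sq, (d t).norm_xi, one_pow]
    rw [h2] at h1
    have h3 := h1.unique (hasDerivAt_const _ _)
    rw [real_inner_comm (d 0).xi] at h3
    linarith
  -- The area vector is a multiple of `ξ`, while the velocity of a unit vector is orthogonal to it.
  have hA : inner ℝ (d 0).areaVector vw.2 = 0 := by
    rw [(d 0).areaVector_eq_sum_sub o, sum_inner]
    refine Finset.sum_eq_zero fun i _ => ?_
    rw [cross_eq_smul_of_inner_eq_zero hξ (ho i).2 (ho (i + 1)).2, inner_smul_left, hwk, mul_zero]
  have hP : ∑ i, inner ℝ (vw.1 (i + 1))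
      (cross ((d 0).vertex (i + 1 + 1) - (d 0).vertex i) (d 0).xi) = 0 := by
    -- The multipliers are four times the signed areas of the triangles formed by the circumcentre
    -- and the edges.
    have h1 := sum_mul_dHalfSqEdges (d 0).vertex vw.1 fun i =>
      2 * inner ℝ (cross ((d 0).vertex i - o) ((d 0).vertex (i + 1) - o)) (d 0).xi
    rw [hvk] at h1
    simp only [Pi.zero_apply, mul_zero, Finset.sum_const_zero] at h1
    refine (Finset.sum_congr rfl fun i _ => congrArg _ ?_).trans h1.symm
    have hr : ∀ j, ‖(d 0).vertex j - o‖ = r := fun j => by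
      rw [← dist_eq_norm]; exact (ho j).1
    have h2 := cross_sub_eq_of_inscribed hξ (hr i) (hr (i + 1)) (hr (i + 1 + 1)) (ho i).2
      (ho (i + 1)).2 (ho (i + 1 + 1)).2
      (by rw [sub_sub_sub_cancel_right]; exact (d 0).norm_edge i)
      (by rw [sub_sub_sub_cancel_right]; exact (d 0).norm_edge (i + 1))
    simpa only [sub_sub_sub_cancel_right] using h2
  have h := hasDerivAt_area hv hw
  rw [hP, hA, add_zero, mul_zero] at h
  refine h.congr_of_eventuallyEq ?_
  filter_upwards [hγ] with t ht
  rw [ht]; rfl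

/-! ### Critical polygons are inscribed -/

/-- The differential of the area in the direction of an infinitesimal flex vanishes at a critical
point. -/
theorem sum_inner_eq_zero_of_isCriticalPoint (hn : Odd n) {c : DecoratedPolygon n}
    (hc : IsCriticalPoint S c.toSpace) {v : Fin n → E3} (hv : dHalfSqEdges c.vertex v = 0) :
    ∑ i, inner ℝ (v (i + 1)) (cross (c.vertex (i + 1 + 1) - c.vertex i) c.xi) = 0 := by
  obtain ⟨q, hq, hq0, hqv, hqG⟩ := exists_curve_in_level_set contDiff_halfSqEdges
    (hasFDerivAt_halfSqEdges c.vertex) (surjective_dHalfSqEdges hn c.norm_edge) hv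
  have hmem : ∀ t, halfSqEdges (q t) = halfSqEdges c.vertex →
      (∀ i : Fin n, dist (q t i) (q t (i + 1)) = 1) ∧ c.xi ∈ Metric.sphere (0 : E3) 1 := by
    refine fun t ht => ⟨fun i => ?_, c.2.2⟩
    rw [halfSqEdges_vertex] at ht
    have h1 := congrFun ht i
    rw [halfSqEdges, real_inner_self_eq_norm_sq] at h1
    rw [dist_comm, dist_eq_norm, ← sq_eq_sq₀ (norm_nonneg _) zero_le_one]
    linarith
  classical
  let d : ℝ → DecoratedPolygon n := fun t =>
    if h : halfSqEdges (q t) = halfSqEdges c.vertex then ⟨(q t, c.xi), hmem t h⟩ else c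
  have hd : (fun t => ((d t).1 : Ambient n)) =ᶠ[𝓝 0] fun t => (q t, c.xi) := by
    filter_upwards [hqG] with t ht
    have : d t = ⟨(q t, c.xi), hmem t ht⟩ := dif_pos ht
    rw [this]
  have hd0 : d 0 = c := by
    refine Subtype.ext (hd.self_of_nhds.trans ?_)
    beta_reduce
    rw [hq0]
    rfl
  have h1 := hc (fun t => (d t).toSpace)
    ⟨d, (hq.prodMk contDiffAt_const).congr_of_eventuallyEq hd, .of_forall fun _ => rfl⟩
    (by rw [hd0])
  have h2 := hasDerivAt_area (c := d) (v := v) (w := 0)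
    (hqv.congr_of_eventuallyEq (hd.fun_comp Prod.fst))
    ((hasDerivAt_const (0 : ℝ) c.xi).congr_of_eventuallyEq (hd.fun_comp Prod.snd))
  have h3 := h2.unique h1
  rw [hd0, inner_zero_right, add_zero] at h3
  linarith

/-- Lagrange multipliers at a critical point of the area. -/
theorem exists_multipliers (hn : Odd n) {c : DecoratedPolygon n}
    (hc : IsCriticalPoint S c.toSpace) :
    ∃ μ : Fin n → ℝ, ∀ i, cross (c.vertex (i + 1 + 1) - c.vertex i) c.xi =
      μ i • (c.vertex (i + 1) - c.vertex i) -
        μ (i + 1) • (c.vertex (i + 1 + 1) - c.vertex (i + 1)) := by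
  obtain ⟨L, hL⟩ := (dHalfSqEdges c.vertex).exists_rightInverse_of_surjective
    (LinearMap.range_eq_top.2 (surjective_dHalfSqEdges hn c.norm_edge))
  let φ : (Fin n → E3) →ₗ[ℝ] ℝ := ∑ i, (innerₛₗ ℝ
    (cross (c.vertex (i + 1 + 1) - c.vertex i) c.xi)) ∘ₗ LinearMap.proj (i + 1)
  have hφ : ∀ v, φ v = ∑ i, inner ℝ (v (i + 1))
      (cross (c.vertex (i + 1 + 1) - c.vertex i) c.xi) := fun v => by
    simp only [φ, LinearMap.sum_apply, LinearMap.comp_apply, LinearMap.proj_apply,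
      innerₛₗ_apply_apply]
    exact Finset.sum_congr rfl fun i _ => real_inner_comm _ _
  -- As `φ` vanishes on the kernel of the constraint differential, it factors through it as `φ ∘ L`;
  -- the multipliers are the coordinates of `φ ∘ L`.
  refine ⟨fun i => φ (L (Pi.single i 1)), congrFun (eq_of_forall_sum_inner_eq fun v => ?_)⟩
  have h1 := sum_inner_eq_zero_of_isCriticalPoint hn hc
    (v := v - L (dHalfSqEdges c.vertex v)) (by
      rw [map_sub, sub_eq_zero]
      exact (congrArg (fun f : (Fin n → ℝ) →L[ℝ] (Fin n → ℝ) => f (dHalfSqEdges c.vertex v))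
        hL).symm)
  rw [← hφ, map_sub, sub_eq_zero] at h1
  rw [← sum_mul_dHalfSqEdges, ← hφ, h1]
  exact linearFunctional_apply_eq_sum (φ ∘ₗ L.toLinearMap) _

/-- Two consecutive multipliers agree up to sign. -/
theorem sq_eq_sq_of_multipliers {e e' ξ : E3} {a b : ℝ} (he : ‖e‖ = 1) (he' : ‖e'‖ = 1)
    (h : cross (e' + e) ξ = a • e - b • e') : b ^ 2 = a ^ 2 := by
  -- Pairing with `e' + e` gives `(a - b) * (1 + ⟪e, e'⟫) = 0`. In the second case `e' = -e`, and
  -- the relation itself reads `(a + b) • e = 0`.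
  have h1 : inner ℝ (cross (e' + e) ξ) (e' + e) = 0 := by
    rw [real_inner_comm, inner_self_cross]
  have h2 : inner ℝ e e = (1 : ℝ) := by rw [real_inner_self_eq_norm_sq, he, one_pow]
  have h3 : inner ℝ e' e' = (1 : ℝ) := by rw [real_inner_self_eq_norm_sq, he', one_pow]
  have h4 : (a - b) * (1 + inner ℝ e e') = 0 := by
    rw [h, inner_sub_left, inner_smul_left, inner_smul_left, inner_add_right, inner_add_right,
      h2, h3, real_inner_comm e e', RCLike.conj_to_real, RCLike.conj_to_real] at h1
    linear_combination h1
  rcases mul_eq_zero.1 h4 with h5 | h5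
  · rw [sub_eq_zero.1 h5]
  · have h6 : e' + e = 0 := by
      rw [← norm_eq_zero, ← sq_eq_zero_iff, norm_add_sq_real, he, he', real_inner_comm]
      linarith
    rw [h6, cross_zero_left, eq_neg_of_add_eq_zero_left h6, smul_neg, sub_neg_eq_add,
      ← add_smul, eq_comm, smul_eq_zero] at h
    have h7 : e ≠ 0 := by rw [← norm_ne_zero_iff, he]; exact one_ne_zero
    rw [eq_neg_of_add_eq_zero_right (h.resolve_right h7), neg_sq]

theorem isInscribed_of_isCriticalPoint (hn : Odd n) {c : DecoratedPolygon n}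
    (hc : IsCriticalPoint S c.toSpace) : c.IsInscribed := by
  obtain ⟨μ, hμ⟩ := exists_multipliers hn hc
  have hξ := c.norm_xi
  have hξ' : inner ℝ c.xi c.xi = (1 : ℝ) := by rw [real_inner_self_eq_norm_sq, hξ, one_pow]
  set e : Fin n → E3 := fun i => c.vertex (i + 1) - c.vertex i with he
  have hee : ∀ i, inner ℝ (e i) (e i) = (1 : ℝ) := fun i => by
    rw [real_inner_self_eq_norm_sq, c.norm_edge, one_pow]
  have hesum : ∑ i, e i = 0 := sum_edges_eq_zero c.vertex
  have hμe : ∀ i, cross (e (i + 1) + e i) c.xi = μ i • e i - μ (i + 1) • e (i + 1) := fun i => by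
    rw [← hμ i, sub_add_sub_cancel]
  have hsq : ∀ i, μ i ^ 2 = μ 0 ^ 2 := cyclic_const fun i =>
    sq_eq_sq_of_multipliers (c.norm_edge i) (c.norm_edge (i + 1)) (hμe i)
  have hC : ∀ i, μ i * inner ℝ (e i) c.xi = μ 0 * inner ℝ (e 0) c.xi := cyclic_const
      (f := fun i => μ i * inner ℝ (e i) c.xi) fun i => by
    have h1 := inner_cross_self_right (e (i + 1) + e i) c.xi
    rw [hμe, inner_sub_left, inner_smul_left, inner_smul_left] at h1
    exact (sub_eq_zero.1 h1).symm
  -- If the multipliers vanish, the vectors `e i × ξ` alternate in sign and sum to zero, so all are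
  -- zero. Then every edge is `± ξ`, and an odd number of those cannot close up.
  have hμ0 : μ 0 ≠ 0 := fun h0 => by
    have hz : ∀ i, μ i = 0 := fun i => by simpa [h0] using hsq i
    have hJ : ∀ i, cross (e i) c.xi = cross (e 0) c.xi ∨
        cross (e i) c.xi = -cross (e 0) c.xi := by
      refine cyclic_induction (Or.inl rfl) fun i hi => ?_
      have h1 := hμe i
      rw [hz, hz, zero_smul, zero_smul, sub_zero, cross_add_left] at h1
      rw [eq_neg_of_add_eq_zero_left h1, neg_inj, neg_eq_iff_eq_neg]
      exact hi.symm
    have hJ0 := eq_zero_of_sum_signs_eq_zero hn hJ (by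
      have h1 := congrArg (fun x => crossL x c.xi) hesum
      simpa only [map_sum, sum_apply, crossL_apply, cross_zero_left] using h1)
    have hh : ∀ i, inner ℝ (e i) c.xi = (1 : ℝ) ∨ inner ℝ (e i) c.xi = (-1 : ℝ) := fun i => by
      have h1 := inner_cross_cross (e i) (e i) c.xi
      have h2 : cross (e i) c.xi = 0 := by
        rcases hJ i with h | h <;> simp [h, hJ0]
      rw [h2, inner_zero_left, hee, hξ', one_mul, ← sq, eq_comm, sub_eq_zero, eq_comm] at h1
      simpa using h1
    refine one_ne_zero (eq_zero_of_sum_signs_eq_zero hn hh ?_)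
    rw [← sum_inner, hesum, inner_zero_left]
  have hperp : ∀ i, inner ℝ (e i) c.xi = 0 := by
    set u := inner ℝ (e 0) c.xi
    have hs : ∀ i, inner ℝ (e i) c.xi = u ∨ inner ℝ (e i) c.xi = -u := fun i => by
      rcases sq_eq_sq_iff_eq_or_eq_neg.1 (hsq i) with h | h
      · exact Or.inl (mul_left_cancel₀ hμ0 (by rw [← hC i, h]))
      · exact Or.inr (mul_left_cancel₀ hμ0 (by linear_combination -hC i + inner ℝ (e i) c.xi * h))
    have hu : u = 0 := eq_zero_of_sum_signs_eq_zero hn hs (by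
      rw [← sum_inner, hesum, inner_zero_left])
    intro i
    rcases hs i with h | h <;> simp [h, hu]
  have hJJ : ∀ i, cross (cross (e i) c.xi) c.xi = -e i := fun i => by
    rw [cross_cross_right, hperp, hξ', zero_smul, one_smul, zero_sub]
  have hJn : ∀ i, inner ℝ (cross (e i) c.xi) (cross (e i) c.xi) = (1 : ℝ) := fun i => by
    rw [inner_cross_cross, hperp, hee, hξ']; ring
  -- This candidate centre lies on the perpendicular bisector of edge `i`, at signed height `μ i /
  -- 2` from its midpoint. The multiplier relation crossed with `ξ` says exactly that `o (i+1) = o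
  -- i`.
  set o : Fin n → E3 := fun i => c.vertex i + (1 / 2 : ℝ) • (e i - μ i • cross (e i) c.xi) with ho
  have hoc : ∀ i, o i = o 0 := cyclic_const fun i => by
    have h1 := congrArg (fun x => cross x c.xi) (hμe i)
    simp only [cross_add_left, cross_sub_left, cross_smul_left, hJJ] at h1
    have h2 : c.vertex (i + 1) = c.vertex i + e i := by simp [he]
    have h3 : μ (i + 1) • cross (e (i + 1)) c.xi =
        μ i • cross (e i) c.xi + e i + e (i + 1) := by
      rw [← sub_eq_zero] at h1 ⊢
      rw [← h1]
      abel
    simp only [ho]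
    rw [h3, h2]
    module
  -- Pythagoras with legs `1 / 2` and `|μ i| / 2`.
  refine ⟨o 0, √((1 + μ 0 ^ 2) / 4), fun i => ?_⟩
  have h1 : c.vertex i - o 0 = -((1 / 2 : ℝ) • (e i - μ i • cross (e i) c.xi)) := by
    rw [← hoc i]; simp [ho]
  rw [dist_eq_norm, h1]
  constructor
  · rw [← Real.sqrt_sq (norm_nonneg _), ← real_inner_self_eq_norm_sq]
    congr 1
    rw [inner_neg_neg]
    simp only [inner_smul_left, inner_smul_right, inner_sub_left, inner_sub_right, hee, hJn,
      inner_self_cross, real_inner_comm (e i) (cross (e i) c.xi), RCLike.conj_to_real]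
    rw [← hsq i]
    ring
  · rw [inner_neg_left, inner_smul_left, inner_sub_left, inner_smul_left, hperp,
      inner_cross_self_right]
    simp

theorem isCriticalPoint_iff (hn : Odd n) (c : DecoratedPolygon n) :
    IsCriticalPoint S c.toSpace ↔ c.IsInscribed :=
  ⟨isInscribed_of_isCriticalPoint hn, isCriticalPoint_of_isInscribed⟩

end DecoratedLinkage

end

theorem mainTheorem2 (n : ℕ) [NeZero n] (hn : Odd n) :
    (∀ c : DecoratedLinkage.DecoratedPolygon n,
      DecoratedLinkage.IsCriticalPoint DecoratedLinkage.S c.toSpace ↔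
        c.IsPlanarCyclic ∧ c.XiOrthogonal) ∧
    (∀ c : DecoratedLinkage.DecoratedPolygon n,
      DecoratedLinkage.IsCriticalPoint DecoratedLinkage.S c.toSpace →
        DecoratedLinkage.IsCriticalPoint DecoratedLinkage.S c.flip.toSpace) := by
  simp only [DecoratedLinkage.isCriticalPoint_iff hn]
  exact ⟨fun c => c.isInscribed_iff, fun _ h => h.flip⟩
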